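/- Let $\mathcal Q$ be a small quantaloid, that is, a small category whose hom-sets are complete lattices and whose composition preserves arbitrary suprema in each variable. A $\mathcal Q$-category $\mathbb A$ consists of a set $\mathbb A_0$ of objects, a type function $t:\mathbb A_0\to\mathcal Q_0$, and arrows $\mathbb A(a',a):ta\to ta'$ in $\mathcal Q$ such that $\mathbb A(a'',a')\circ\mathbb A(a',a)\le\mathbb A(a'',a)$ and $1_{ta}\le\mathbb A(a,a)$. A functor $F:\mathbb A\to\mathbb B$ is a type-preserving map of objects with $\mathbb A(a',a)\le\mathbb B(Fa',Fa)$; functors are ordered by $F\le G$ iff $1_{ta}\le\mathbb B(Fa,Ga)$ for all $a$. A distributor $\Phi:\mathbb A\to\mathbb B$ consists of arrows $\Phi(b,a):ta\to tb$ with $\mathbb B(b,b')\circ\Phi(b',a)\le\Phi(b,a)$ and $\Phi(b,a')\circ\mathbb A(a',a)\le\Phi(b,a)$; with composition $(\Psi\otimes\Phi)(c,a)=\bigvee_b\Psi(c,b)\circ\Phi(b,a)$, identities $\mathbb A(-,-)$ and elementwise order, distributors form a quantaloid. In a locally ordered category, $f:X\to Y$ is left adjoint to $g:Y\to X$ when $1_X\le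 g\circ f$ and $f\circ g\le 1_Y$. A $\mathcal Q$-category $\mathbb C$ is Cauchy complete if, for every $\mathcal Q$-category $\mathbb A$, every left adjoint distributor $\mathbb A\to\mathbb C$ is of the form $\mathbb C(-,F-)$ for some functor $F:\mathbb A\to\mathbb C$. Let $\mathsf{Cat}_{\mathsf{cc}}(\mathcal Q)$ be the locally ordered category of Cauchy complete $\mathcal Q$-categories and all functors between them. Let $\mathsf{Sup}$ be the quantaloid of complete lattices and supremum-preserving maps. A $\mathcal Q$-module is a functor $\mathcal F:\mathcal Q^{\mathrm{op}}\to\mathsf{Sup}$ preserving suprema of morphisms. With natural transformations (having components in $\mathsf{Sup}$) as morphisms, ordered elementwise, $\mathcal Q$-modules form a quantaloid $\mathsf{Mod}(\mathcal Q)$. For $a\in\mathcal F(A)$ let $\tau_a:\mathcal Q(-,A)\to\mathcal F$ be the module morphism $f\mapsto\mathcal F(f)(a)$; the element $a$ is principal if $\tau_a$ is a left adjoint in $\mathsf{Mod}(\mathcal Q)$. The module $\mathcal F$ is principally generated if, for every $X\in\mathcal Q$ and every $x\in\mathcal F(X)$, $$\tau_x=\bigvee\{\tau_a\circ[\tau_a,\tau_x]\mid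 a\text{ a principal element of }\mathcal F\},$$ where $[\tau_a,\tau_x]$ is the largest module morphism $\theta$ with $\tau_a\circ\theta\le\tau_x$. Let $\mathsf{Mod}_{\mathsf{pg}}(\mathcal Q)$ be the full subquantaloid of $\mathsf{Mod}(\mathcal Q)$ on the principally generated modules, and $\mathsf{Map}(\mathsf{Mod}_{\mathsf{pg}}(\mathcal Q))$ the locally ordered category with the same objects and with its left adjoints as morphisms. Then the locally ordered categories $\mathsf{Cat}_{\mathsf{cc}}(\mathcal Q)$ and $\mathsf{Map}(\mathsf{Mod}_{\mathsf{pg}}(\mathcal Q))$, viewed as bicategories with a unique 2-cell $f\Rightarrow g$ exactly when $f\le g$, are biequivalent. -/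

import Mathlib

open CategoryTheory

universe v u

namespace Qtld

/-! ### Locally ordered categories, as bicategories -/

/-- A locally ordered category: a category whose hom-sets are (pre)ordered in such a way that
composition is monotone in both variables. -/
class LocallyOrdered (C : Type u) extends Category.{v} C where
  homPreorder : ∀ X Y : C, Preorder (X ⟶ Y)
  comp_mono : ∀ {X Y Z : C} {f f' : X ⟶ Y} {g g' : Y ⟶ Z}, f ≤ f' → g ≤ g' → f ≫ g ≤ f' ≫ g'

attribute [reducible, instance] LocallyOrdered.homPreorder

/-- A locally ordered category is a (strict, locally thin) bicategory: there is a single 2-cell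
`f ⟶ g` if `f ≤ g`, and none otherwise. -/
instance LocallyOrdered.bicategory (C : Type u) [LocallyOrdered.{v} C] :
    Bicategory.{v, v} C where
  homCategory X Y := Preorder.smallCategory (X ⟶ Y)
  whiskerLeft f _ _ η := homOfLE (LocallyOrdered.comp_mono (le_refl f) (leOfHom η))
  whiskerRight η h := homOfLE (LocallyOrdered.comp_mono (leOfHom η) (le_refl h))
  associator f g h := eqToIso (Category.assoc f g h)
  leftUnitor f := eqToIso (Category.id_comp f)
  rightUnitor f := eqToIso (Category.comp_id f)
  whiskerLeft_id _ _ := Subsingleton.elim _ _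
  whiskerLeft_comp _ _ _ _ _ _ := Subsingleton.elim _ _
  id_whiskerLeft _ := Subsingleton.elim _ _
  comp_whiskerLeft _ _ _ _ _ := Subsingleton.elim _ _
  id_whiskerRight _ _ := Subsingleton.elim _ _
  comp_whiskerRight _ _ _ := Subsingleton.elim _ _
  whiskerRight_id _ := Subsingleton.elim _ _
  whiskerRight_comp _ _ _ := Subsingleton.elim _ _
  whisker_assoc _ _ _ _ _ := Subsingleton.elim _ _
  whisker_exchange _ _ := Subsingleton.elim _ _
  pentagon _ _ _ _ := Subsingleton.elim _ _
  triangle _ _ := Subsingleton.elim _ _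

/-- `f` is left adjoint to `g` in a locally ordered category:
`1 ≤ g ∘ f` and `f ∘ g ≤ 1`. -/
def Adj {C : Type u} [LocallyOrdered.{v} C] {X Y : C} (f : X ⟶ Y) (g : Y ⟶ X) : Prop :=
  𝟙 X ≤ f ≫ g ∧ g ≫ f ≤ 𝟙 Y

/-- A map in a locally ordered category is a left adjoint, i.e. a morphism that has a right
adjoint. -/
def IsMap {C : Type u} [LocallyOrdered.{v} C] {X Y : C} (f : X ⟶ Y) : Prop :=
  ∃ g : Y ⟶ X, Adj f g

lemma IsMap.id {C : Type u} [LocallyOrdered.{v} C] (X : C) : IsMap (𝟙 X) :=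
  ⟨𝟙 X, by simp [Adj]⟩

lemma IsMap.comp {C : Type u} [LocallyOrdered.{v} C] {X Y Z : C} {f : X ⟶ Y} {g : Y ⟶ Z}
    (hf : IsMap f) (hg : IsMap g) : IsMap (f ≫ g) := by
  obtain ⟨f', h1, h2⟩ := hf
  obtain ⟨g', h3, h4⟩ := hg
  refine ⟨g' ≫ f', ?_, ?_⟩
  · have h := LocallyOrdered.comp_mono (LocallyOrdered.comp_mono (le_refl f) h3) (le_refl f')
    simp only [Category.comp_id, Category.assoc] at h
    simpa only [Category.assoc] using le_trans h1 h
  · have h := LocallyOrdered.comp_mono (LocallyOrdered.comp_mono (le_refl g') h2) (le_refl g)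
    simp only [Category.comp_id, Category.assoc] at h
    simpa only [Category.assoc] using le_trans h h4

/-- `MapCat C` is `Map(C)`: same objects as `C`, the left adjoints of `C` as morphisms, with the
local order of `C`. -/
structure MapCat (C : Type u) where
  obj : C

instance MapCat.locallyOrdered (C : Type u) [LocallyOrdered.{v} C] :
    LocallyOrdered.{v} (MapCat C) where
  Hom X Y := {f : X.obj ⟶ Y.obj // IsMap f}
  id X := ⟨𝟙 X.obj, IsMap.id X.obj⟩
  comp f g := ⟨f.1 ≫ g.1, f.2.comp g.2⟩
  id_comp f := Subtype.ext (Category.id_comp f.1)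
  comp_id f := Subtype.ext (Category.comp_id f.1)
  assoc f g h := Subtype.ext (Category.assoc f.1 g.1 h.1)
  homPreorder X Y := Preorder.lift (fun f : {f : X.obj ⟶ Y.obj // IsMap f} => f.1)
  comp_mono hf hg := LocallyOrdered.comp_mono (C := C) hf hg

/-- The full sub-2-category of a locally ordered category on the objects satisfying `P`. -/
structure FullSub {C : Type u} (P : C → Prop) where
  obj : C
  property : P obj

instance FullSub.locallyOrdered {C : Type u} [LocallyOrdered.{v} C] (P : C → Prop) :
    LocallyOrdered.{v} (FullSub P) where
  Hom X Y := X.obj ⟶ Y.obj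
  id X := 𝟙 X.obj
  comp {X Y Z} f g := CategoryStruct.comp (obj := C) (X := X.obj) (Y := Y.obj) (Z := Z.obj) f g
  id_comp f := Category.id_comp (obj := C) f
  comp_id f := Category.comp_id (obj := C) f
  assoc f g h := Category.assoc (obj := C) f g h
  homPreorder X Y := LocallyOrdered.homPreorder X.obj Y.obj
  comp_mono hf hg := LocallyOrdered.comp_mono (C := C) hf hg

/-- Two bicategories are biequivalent: there are pseudofunctors `F` and `G` in opposite directions
such that `G ∘ F` and `F ∘ G` are equivalent to the identity pseudofunctors, in the bicategory of
pseudofunctors, strong (pseudonatural) transformations and modifications. -/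
def Biequivalent (B : Type*) (C : Type*) [Bicategory B] [Bicategory C] : Prop :=
  open scoped Pseudofunctor.StrongTrans in
  ∃ (F : Pseudofunctor B C) (G : Pseudofunctor C B),
    Nonempty (Bicategory.Equivalence (F.comp G) (Pseudofunctor.id B)) ∧
    Nonempty (Bicategory.Equivalence (G.comp F) (Pseudofunctor.id C))

/-! ### Quantaloids -/

/-- A quantaloid: a category enriched in complete lattices and supremum-preserving maps, i.e. the
hom-sets are complete lattices and composition preserves arbitrary suprema in each variable. -/
class Quantaloid (Q : Type u) extends Category.{v} Q where
  homLattice : ∀ X Y : Q, CompleteLattice (X ⟶ Y)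
  sSup_comp : ∀ {X Y Z : Q} (S : Set (X ⟶ Y)) (g : Y ⟶ Z),
    sSup S ≫ g = sSup ((fun f => f ≫ g) '' S)
  comp_sSup : ∀ {X Y Z : Q} (f : X ⟶ Y) (S : Set (Y ⟶ Z)),
    f ≫ sSup S = sSup ((fun g => f ≫ g) '' S)

attribute [reducible, instance] Quantaloid.homLattice

section

variable {Q : Type u} [Quantaloid.{v} Q]

lemma Quantaloid.iSup_comp {X Y Z : Q} {ι : Sort*} (f : ι → (X ⟶ Y)) (g : Y ⟶ Z) :
    (⨆ i, f i) ≫ g = ⨆ i, f i ≫ g := by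
  rw [iSup, Quantaloid.sSup_comp, ← Set.range_comp]; rfl

lemma Quantaloid.comp_iSup {X Y Z : Q} {ι : Sort*} (f : X ⟶ Y) (g : ι → (Y ⟶ Z)) :
    f ≫ (⨆ i, g i) = ⨆ i, f ≫ g i := by
  rw [iSup, Quantaloid.comp_sSup, ← Set.range_comp]; rfl

lemma Quantaloid.comp_le_comp {X Y Z : Q} {f f' : X ⟶ Y} {g g' : Y ⟶ Z}
    (hf : f ≤ f') (hg : g ≤ g') : f ≫ g ≤ f' ≫ g' := by
  have h1 : f ≫ g ≤ f' ≫ g := by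
    have h := Quantaloid.sSup_comp {f, f'} g
    rw [sSup_pair, sup_eq_right.2 hf, Set.image_pair, sSup_pair] at h
    rw [h]; exact le_sup_left
  have h2 : f' ≫ g ≤ f' ≫ g' := by
    have h := Quantaloid.comp_sSup f' {g, g'}
    rw [sSup_pair, sup_eq_right.2 hg, Set.image_pair, sSup_pair] at h
    rw [h]; exact le_sup_left
  exact h1.trans h2

end

/-- A quantaloid is in particular a locally ordered category. -/
instance Quantaloid.locallyOrdered (Q : Type u) [Quantaloid.{v} Q] : LocallyOrdered.{v} Q where
  homPreorder X Y := (Quantaloid.homLattice X Y).toPreorder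
  comp_mono := Quantaloid.comp_le_comp

/-- The lifting `[f, g]` of `g : A ⟶ Y` through `f : X ⟶ Y` in a quantaloid: the largest
`h : A ⟶ X` with `f ∘ h ≤ g`. -/
def lifting {Q : Type u} [Quantaloid.{v} Q] {A X Y : Q} (f : X ⟶ Y) (g : A ⟶ Y) : A ⟶ X :=
  sSup {h | h ≫ f ≤ g}

lemma le_lifting_iff {Q : Type u} [Quantaloid.{v} Q] {A X Y : Q} (f : X ⟶ Y) (g : A ⟶ Y)
    (h : A ⟶ X) : h ≤ lifting f g ↔ h ≫ f ≤ g := by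
  constructor
  · intro hh
    refine (Quantaloid.comp_le_comp hh le_rfl).trans ?_
    rw [lifting, Quantaloid.sSup_comp]
    refine sSup_le ?_
    rintro _ ⟨k, hk, rfl⟩
    exact hk
  · exact fun hh => le_sSup hh

/-! ### Categories enriched in a quantaloid -/

/-- A category enriched in the quantaloid `Q`. The set `𝔸₀` of objects with its type function
`t : 𝔸₀ → Q₀` is encoded as the family of its fibres: `Obj X` is the set of objects of type `X`,
so that `𝔸₀ = Σ X, Obj X` and `t` is the first projection.
For `a` of type `X` and `a'` of type `Y`, `hom a' a : X ⟶ Y` is the hom-arrow `𝔸(a', a)`. -/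
structure QCat (Q : Type u) [Quantaloid.{u} Q] where
  Obj : Q → Type u
  hom : ∀ {X Y : Q}, Obj Y → Obj X → (X ⟶ Y)
  hom_comp : ∀ {X Y Z : Q} (a'' : Obj Z) (a' : Obj Y) (a : Obj X),
    hom a' a ≫ hom a'' a' ≤ hom a'' a
  hom_id : ∀ {X : Q} (a : Obj X), 𝟙 X ≤ hom a a

section

variable {Q : Type u} [Quantaloid.{u} Q]

/-- A functor between `Q`-enriched categories: a type-preserving map on objects such that
`𝔸(a', a) ≤ 𝔹(F a', F a)`. -/
@[ext]
structure QFunctor (A B : QCat Q) where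
  obj : ∀ {X : Q}, A.Obj X → B.Obj X
  hom_le : ∀ {X Y : Q} (a' : A.Obj Y) (a : A.Obj X), A.hom a' a ≤ B.hom (obj a') (obj a)

/-- `Cat(Q)`, the locally ordered category of `Q`-categories and functors. The order on functors is
`F ≤ G` iff `F a ≤ G a` for all `a`, where `b ≤ b'` for two objects of the same type `X` means
`1_X ≤ 𝔹(b, b')`. -/
instance QCat.locallyOrdered : LocallyOrdered.{u} (QCat Q) where
  Hom A B := QFunctor A B
  id A := { obj := fun a => a, hom_le := fun _ _ => le_rfl }
  comp F G :=
    { obj := fun a => G.obj (F.obj a)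
      hom_le := fun a' a => (F.hom_le a' a).trans (G.hom_le (F.obj a') (F.obj a)) }
  id_comp _ := rfl
  comp_id _ := rfl
  assoc _ _ _ := rfl
  homPreorder A B :=
    { le := fun F G => ∀ (X : Q) (a : A.Obj X), 𝟙 X ≤ B.hom (F.obj a) (G.obj a)
      le_refl := fun F X a => B.hom_id (F.obj a)
      le_trans := fun F G H hFG hGH X a => by
        have h := Quantaloid.comp_le_comp (hGH X a) (hFG X a)
        rw [Category.id_comp] at h
        exact h.trans (B.hom_comp _ _ _) }
  comp_mono {A B C F F' G G'} hF hG := fun X a => by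
    have h1 : 𝟙 X ≤ C.hom (G.obj (F.obj a)) (G.obj (F'.obj a)) :=
      (hF X a).trans (G.hom_le _ _)
    have h := Quantaloid.comp_le_comp (hG X (F'.obj a)) h1
    rw [Category.id_comp] at h
    exact h.trans (C.hom_comp _ _ _)

/-- A distributor `Φ : 𝔸 ⇸ 𝔹`: for `a` of type `X` and `b` of type `Y` an arrow
`Φ(b, a) : X ⟶ Y`, with actions of the hom-arrows of `𝔸` and `𝔹`. -/
@[ext]
structure Distributor (A B : QCat Q) where
  app : ∀ {X Y : Q}, B.Obj Y → A.Obj X → (X ⟶ Y)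
  act_left : ∀ {X Y Z : Q} (b : B.Obj Z) (b' : B.Obj Y) (a : A.Obj X),
    app b' a ≫ B.hom b b' ≤ app b a
  act_right : ∀ {X Y Z : Q} (b : B.Obj Z) (a' : A.Obj Y) (a : A.Obj X),
    A.hom a' a ≫ app b a' ≤ app b a

namespace Distributor

/-- The identity distributor, given by the hom-arrows. -/
def id (A : QCat Q) : Distributor A A where
  app a' a := A.hom a' a
  act_left b b' a := A.hom_comp b b' a
  act_right _ _ _ := A.hom_comp _ _ _

/-- The composite `Ψ ⊗ Φ`, with elements `(Ψ ⊗ Φ)(c, a) = ⋁_b Ψ(c, b) ∘ Φ(b, a)`. -/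
def comp {A B C : QCat Q} (Φ : Distributor A B) (Ψ : Distributor B C) : Distributor A C where
  app c a := ⨆ (Y : Q) (b : B.Obj Y), Φ.app b a ≫ Ψ.app c b
  act_left c c' a := by
    simp only [Quantaloid.iSup_comp, Category.assoc]
    exact iSup_mono fun Y => iSup_mono fun b =>
      Quantaloid.comp_le_comp le_rfl (Ψ.act_left c c' b)
  act_right c a' a := by
    simp only [Quantaloid.comp_iSup, ← Category.assoc]
    exact iSup_mono fun Y => iSup_mono fun b =>
      Quantaloid.comp_le_comp (Φ.act_right b a' a) le_rfl

/-- Distributors are ordered elementwise. -/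
instance (A B : QCat Q) : PartialOrder (Distributor A B) where
  le Φ Ψ := ∀ (X Y : Q) (b : B.Obj Y) (a : A.Obj X), Φ.app b a ≤ Ψ.app b a
  le_refl Φ X Y b a := le_rfl
  le_trans Φ Ψ Θ h h' X Y b a := (h X Y b a).trans (h' X Y b a)
  le_antisymm Φ Ψ h h' := by
    ext X Y b a
    exact le_antisymm (h X Y b a) (h' X Y b a)

/-- Suprema of distributors are computed elementwise. -/
instance (A B : QCat Q) : SupSet (Distributor A B) where
  sSup S :=
    { app := fun b a => ⨆ Φ : S, Φ.1.app b a
      act_left := fun b b' a => by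
        rw [Quantaloid.iSup_comp]
        exact iSup_mono fun Φ => Φ.1.act_left b b' a
      act_right := fun b a' a => by
        rw [Quantaloid.comp_iSup]
        exact iSup_mono fun Φ => Φ.1.act_right b a' a }

instance (A B : QCat Q) : CompleteLattice (Distributor A B) :=
  completeLatticeOfSup _ fun S =>
    ⟨fun Φ hΦ _ _ b a => le_iSup (fun Φ : S => Φ.1.app b a) ⟨Φ, hΦ⟩,
      fun _ hΨ X Y b a => iSup_le fun Φ => hΨ Φ.2 X Y b a⟩

lemma sSup_app {A B : QCat Q} (S : Set (Distributor A B)) {X Y : Q} (b : B.Obj Y)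
    (a : A.Obj X) : (sSup S).app b a = ⨆ Φ : S, Φ.1.app b a := rfl

end Distributor

/-- The objects of `Dist(Q)` are the `Q`-categories. -/
structure DistCat (Q : Type u) [Quantaloid.{u} Q] where
  obj : QCat Q

/-- `Dist(Q)`, the quantaloid of `Q`-categories and distributors. -/
instance DistCat.quantaloid : Quantaloid.{u} (DistCat Q) where
  Hom A B := Distributor A.obj B.obj
  id A := Distributor.id A.obj
  comp Φ Ψ := Distributor.comp Φ Ψ
  id_comp {A B} Φ := by
    ext X Y b a
    refine le_antisymm (iSup_le fun Z => iSup_le fun a' => Φ.act_right b a' a) ?_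
    refine le_trans ?_ (le_iSup_of_le X (le_iSup_of_le a le_rfl))
    calc Φ.app b a = 𝟙 X ≫ Φ.app b a := (Category.id_comp _).symm
      _ ≤ _ := Quantaloid.comp_le_comp (A.obj.hom_id a) le_rfl
  comp_id {A B} Φ := by
    ext X Y b a
    refine le_antisymm (iSup_le fun Z => iSup_le fun b' => Φ.act_left b b' a) ?_
    refine le_trans ?_ (le_iSup_of_le Y (le_iSup_of_le b le_rfl))
    calc Φ.app b a = Φ.app b a ≫ 𝟙 Y := (Category.comp_id _).symm
      _ ≤ _ := Quantaloid.comp_le_comp le_rfl (B.obj.hom_id b)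
  assoc {A B C D} Φ Ψ Θ := by
    ext X Y d a
    simp only [Distributor.comp, Quantaloid.iSup_comp, Quantaloid.comp_iSup, Category.assoc]
    refine le_antisymm ?_ ?_
    · exact iSup_le fun Z => iSup_le fun c => iSup_le fun W => iSup_le fun b =>
        le_iSup_of_le W (le_iSup_of_le b (le_iSup_of_le Z (le_iSup_of_le c le_rfl)))
    · exact iSup_le fun Z => iSup_le fun c => iSup_le fun W => iSup_le fun b =>
        le_iSup_of_le W (le_iSup_of_le b (le_iSup_of_le Z (le_iSup_of_le c le_rfl)))
  homLattice A B := inferInstanceAs (CompleteLattice (Distributor A.obj B.obj))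
  sSup_comp {A B C} S Ψ := by
    ext X Y c a
    rw [Distributor.sSup_app]
    simp only [Distributor.comp, Distributor.sSup_app, Quantaloid.iSup_comp]
    refine le_antisymm ?_ ?_
    · exact iSup_le fun Z => iSup_le fun b => iSup_le fun Φ =>
        le_iSup_of_le ⟨_, Φ.1, Φ.2, rfl⟩ (le_iSup_of_le Z (le_iSup_of_le b le_rfl))
    · refine iSup_le ?_
      rintro ⟨_, Φ, hΦ, rfl⟩
      exact iSup_mono fun Z => iSup_mono fun b => le_iSup_of_le ⟨Φ, hΦ⟩ le_rfl
  comp_sSup {A B C} Φ S := by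
    ext X Y c a
    rw [Distributor.sSup_app]
    simp only [Distributor.comp, Distributor.sSup_app, Quantaloid.comp_iSup]
    refine le_antisymm ?_ ?_
    · exact iSup_le fun Z => iSup_le fun b => iSup_le fun Ψ =>
        le_iSup_of_le ⟨_, Ψ.1, Ψ.2, rfl⟩ (le_iSup_of_le Z (le_iSup_of_le b le_rfl))
    · refine iSup_le ?_
      rintro ⟨_, Ψ, hΨ, rfl⟩
      exact iSup_mono fun Z => iSup_mono fun b => le_iSup_of_le ⟨Ψ, hΨ⟩ le_rfl

/-- The distributor `𝔹(-, F-) : 𝔸 ⇸ 𝔹` represented by a functor `F : 𝔸 ⟶ 𝔹`. -/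
def QFunctor.represented {A B : QCat Q} (F : QFunctor A B) : Distributor A B where
  app b a := B.hom b (F.obj a)
  act_left b b' a := B.hom_comp b b' (F.obj a)
  act_right _ a' a :=
    (Quantaloid.comp_le_comp (F.hom_le a' a) le_rfl).trans (B.hom_comp _ _ _)

/-- A `Q`-category is Cauchy complete when every left adjoint distributor into it is represented
by a functor. -/
def IsCauchyComplete (C : QCat Q) : Prop :=
  ∀ (A : QCat Q) (Φ : DistCat.mk A ⟶ DistCat.mk C), IsMap Φ →
    ∃ F : QFunctor A C, F.represented = Φ

end

/-- `Cat_cc(Q)`: the Cauchy complete `Q`-categories with all functors between them. -/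
abbrev CatCC (Q : Type u) [Quantaloid.{u} Q] : Type (u + 1) :=
  FullSub (C := QCat Q) IsCauchyComplete

/-! ### Modules on a quantaloid -/

/-- A module on the quantaloid `Q`, i.e. a homomorphism of quantaloids (a functor that preserves
suprema of morphisms) from `Qᵒᵖ` to the quantaloid of complete lattices and
supremum-preserving maps. -/
structure QMod (Q : Type u) [Quantaloid.{u} Q] where
  obj : Q → Type u
  lattice : ∀ X, CompleteLattice (obj X)
  map : ∀ {X Y : Q}, (X ⟶ Y) → sSupHom (obj Y) (obj X)
  map_id : ∀ {X : Q} (x : obj X), map (𝟙 X) x = x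
  map_comp : ∀ {X Y Z : Q} (f : X ⟶ Y) (g : Y ⟶ Z) (z : obj Z), map (f ≫ g) z = map f (map g z)
  sSup_map : ∀ {X Y : Q} (S : Set (X ⟶ Y)) (y : obj Y),
    map (sSup S) y = sSup ((fun f => map f y) '' S)

attribute [instance] QMod.lattice

section

variable {Q : Type u} [Quantaloid.{u} Q]

/-- A module morphism: a natural transformation with supremum-preserving components. -/
@[ext]
structure QModHom (F G : QMod Q) where
  app : ∀ X : Q, sSupHom (F.obj X) (G.obj X)
  naturality : ∀ {X Y : Q} (f : X ⟶ Y) (y : F.obj Y), app X (F.map f y) = G.map f (app Y y)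

namespace QModHom

/-- The identity module morphism. -/
def id (F : QMod Q) : QModHom F F where
  app X := sSupHom.id (F.obj X)
  naturality _ _ := rfl

/-- Composition of module morphisms. -/
def comp {F G H : QMod Q} (α : QModHom F G) (β : QModHom G H) : QModHom F H where
  app X := (β.app X).comp (α.app X)
  naturality f y := by
    simp only [sSupHom.comp_apply, α.naturality, β.naturality]

/-- Module morphisms are ordered elementwise. -/
instance (F G : QMod Q) : PartialOrder (QModHom F G) where
  le α β := ∀ (X : Q) (x : F.obj X), α.app X x ≤ β.app X x
  le_refl α X x := le_rfl
  le_trans α β γ h h' X x := (h X x).trans (h' X x)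
  le_antisymm α β h h' := by
    ext X x
    exact le_antisymm (h X x) (h' X x)

/-- Suprema of module morphisms are computed elementwise. -/
instance (F G : QMod Q) : SupSet (QModHom F G) where
  sSup S :=
    { app := fun X =>
        { toFun := fun x => ⨆ α : S, α.1.app X x
          map_sSup' := fun s => by
            simp only [map_sSup, sSup_image]
            rw [iSup_comm]
            exact iSup_congr fun x => iSup_comm }
      naturality := fun {X Y} f y => by
        change (⨆ α : S, α.1.app X (F.map f y)) = G.map f (⨆ α : S, α.1.app Y y)
        rw [map_iSup]
        exact iSup_congr fun α => α.1.naturality f y }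

instance (F G : QMod Q) : CompleteLattice (QModHom F G) :=
  completeLatticeOfSup _ fun S =>
    ⟨fun α hα X x => le_iSup (fun α : S => α.1.app X x) ⟨α, hα⟩,
      fun _ hβ X x => iSup_le fun α => hβ α.2 X x⟩

lemma sSup_app {F G : QMod Q} (S : Set (QModHom F G)) (X : Q) (x : F.obj X) :
    (sSup S).app X x = ⨆ α : S, α.1.app X x := rfl

end QModHom

/-- `Mod(Q)`, the (large) quantaloid of modules on `Q`. -/
instance QMod.quantaloid : Quantaloid.{u} (QMod Q) where
  Hom F G := QModHom F G
  id F := QModHom.id F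
  comp α β := QModHom.comp α β
  id_comp _ := rfl
  comp_id _ := rfl
  assoc _ _ _ := rfl
  homLattice F G := inferInstanceAs (CompleteLattice (QModHom F G))
  sSup_comp {F G H} S β := by
    ext X x
    rw [QModHom.sSup_app]
    change β.app X (⨆ α : S, α.1.app X x) = _
    rw [map_iSup]
    refine le_antisymm (iSup_le fun α => le_iSup_of_le ⟨_, α.1, α.2, rfl⟩ le_rfl) (iSup_le ?_)
    rintro ⟨_, α, hα, rfl⟩
    exact le_iSup_of_le ⟨α, hα⟩ le_rfl
  comp_sSup {F G H} α S := by
    ext X x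
    rw [QModHom.sSup_app]
    change (⨆ β : S, β.1.app X (α.app X x)) = _
    refine le_antisymm (iSup_le fun β => le_iSup_of_le ⟨_, β.1, β.2, rfl⟩ le_rfl) (iSup_le ?_)
    rintro ⟨_, β, hβ, rfl⟩
    exact le_iSup_of_le ⟨β, hβ⟩ le_rfl

/-- The representable module `Q(-, A)`. -/
def representable (A : Q) : QMod Q where
  obj X := X ⟶ A
  lattice X := Quantaloid.homLattice X A
  map f :=
    { toFun := fun g => f ≫ g
      map_sSup' := fun S => Quantaloid.comp_sSup f S }
  map_id g := Category.id_comp g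
  map_comp f g h := Category.assoc f g h
  sSup_map S g := Quantaloid.sSup_comp S g

/-- The module morphism `τ_a : Q(-, A) ⟶ F` that corresponds to `a ∈ F(A)` by the enriched Yoneda
lemma: it sends `f : X ⟶ A` to `F(f)(a)`. -/
def tau (F : QMod Q) {A : Q} (a : F.obj A) : representable A ⟶ F where
  app X :=
    { toFun := fun f : X ⟶ A => F.map f a
      map_sSup' := fun S => F.sSup_map S a }
  naturality f g := F.map_comp f g a

/-- `a ∈ F(A)` is a principal element of the module `F` if `τ_a` is a left adjoint in `Mod(Q)`. -/
def IsPrincipal (F : QMod Q) {A : Q} (a : F.obj A) : Prop :=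
  IsMap (tau F a)

/-- A module `F` is principally generated if `τ_x = ⋁ {τ_a ∘ [τ_a, τ_x] | a ∈ F principal}` for
each `x ∈ F`, where `[τ_a, τ_x]` is the lifting in the quantaloid `Mod(Q)`. -/
def IsPrincipallyGenerated (F : QMod Q) : Prop :=
  ∀ (X : Q) (x : F.obj X),
    tau F x = sSup {θ | ∃ (A : Q) (a : F.obj A), IsPrincipal F a ∧
      θ = lifting (tau F a) (tau F x) ≫ tau F a}

end

/-- `Mod_pg(Q)`: the principally generated `Q`-modules with all module morphisms between them. -/
abbrev ModPG (Q : Type u) [Quantaloid.{u} Q] : Type (u + 1) :=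
  FullSub (C := QMod Q) IsPrincipallyGenerated

end Qtld

namespace Qtld

/-! ### Biequivalences of locally ordered categories -/

namespace LocallyOrdered

universe v₁ v₂ u₁ u₂

section

variable {C : Type u} [LocallyOrdered.{v} C]

/-! The comparison sends a module to the `Q`-category of its principal elements, with hom-arrow
`F.hom a x`, the largest `f` with `F(f)(a) ≤ x`. It is a strict functor on left adjoints, because
these preserve principal elements. All 2-cells are thin and coherence is free, so it suffices that
this functor be an order equivalence on hom-sets and essentially surjective. An element `a` is
principal exactly when `F.hom a -` preserves suprema and the action of `Q`, and a module is
principally generated when every `x` is the join of the `F(F.hom a x)(a)` over principal `a`. Hence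
morphisms out of such a module are determined by their values on principal elements
(`IsPrincipallyGenerated.le_of_le`), and every functor between categories of principal elements
extends to a left adjoint (`exists_isMap_extension`). Principal elements form a Cauchy complete
category, since a colimit of principal elements weighted by a left adjoint distributor is again
principal (`isCauchyComplete_principal`). Conversely, for Cauchy complete `C`, the principal
presheaves are the representable ones: evaluation is a left adjoint distributor into `C`
(`isMap_evalDistributor`), and the functor representing it inverts the Yoneda embedding. -/

instance subsingleton_hom₂ {X Y : C} (f g : X ⟶ Y) : Subsingleton (f ⟶ g) :=
  inferInstanceAs (Subsingleton (ULift (PLift (f ≤ g))))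

/-- Two parallel morphisms of a locally ordered category are isomorphic if each is below the
other. -/
def Rel {X Y : C} (f g : X ⟶ Y) : Prop := f ≤ g ∧ g ≤ f

lemma Rel.refl {X Y : C} (f : X ⟶ Y) : Rel f f := ⟨le_rfl, le_rfl⟩

lemma Rel.of_eq {X Y : C} {f g : X ⟶ Y} (h : f = g) : Rel f g := h ▸ Rel.refl f

lemma Rel.symm {X Y : C} {f g : X ⟶ Y} (h : Rel f g) : Rel g f := ⟨h.2, h.1⟩

lemma Rel.trans {X Y : C} {f g h : X ⟶ Y} (h₁ : Rel f g) (h₂ : Rel g h) : Rel f h :=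
  ⟨h₁.1.trans h₂.1, h₂.2.trans h₁.2⟩

lemma Rel.comp {X Y Z : C} {f f' : X ⟶ Y} {g g' : Y ⟶ Z} (hf : Rel f f') (hg : Rel g g') :
    Rel (f ≫ g) (f' ≫ g') :=
  ⟨comp_mono hf.1 hg.1, comp_mono hf.2 hg.2⟩

lemma Rel.comp_cancel {W X Y Z : C} {f : X ⟶ Y} {g : Y ⟶ X} (h : Rel (f ≫ g) (𝟙 X))
    (k : W ⟶ X) (l : X ⟶ Z) : Rel ((k ≫ f) ≫ (g ≫ l)) (k ≫ l) := by
  have h' := ((Rel.refl k).comp h).comp (Rel.refl l)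
  simpa only [Category.assoc, Category.comp_id] using h'

/-- Isomorphic morphisms are isomorphic objects of the hom-category. -/
def Rel.iso {X Y : C} {f g : X ⟶ Y} (h : Rel f g) : f ≅ g where
  hom := homOfLE h.1
  inv := homOfLE h.2
  hom_inv_id := Subsingleton.elim _ _
  inv_hom_id := Subsingleton.elim _ _

end

variable {B : Type u₁} [LocallyOrdered.{v₁} B] {C : Type u₂} [LocallyOrdered.{v₂} C]

/-- A locally monotone assignment that is functorial up to isomorphism is a pseudofunctor. -/
def pseudofunctor (obj : B → C) (map : ∀ {X Y : B}, (X ⟶ Y) → (obj X ⟶ obj Y))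
    (mono : ∀ {X Y : B} {f g : X ⟶ Y}, f ≤ g → map f ≤ map g)
    (map_id : ∀ X : B, Rel (map (𝟙 X)) (𝟙 (obj X)))
    (map_comp : ∀ {X Y Z : B} (f : X ⟶ Y) (g : Y ⟶ Z), Rel (map (f ≫ g)) (map f ≫ map g)) :
    Pseudofunctor B C where
  obj := obj
  map := map
  map₂ η := homOfLE (mono (leOfHom η))
  map₂_id _ := Subsingleton.elim _ _
  map₂_comp _ _ := Subsingleton.elim _ _
  mapId X := (map_id X).iso
  mapComp f g := (map_comp f g).iso
  map₂_whisker_left _ _ _ _ := Subsingleton.elim _ _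
  map₂_whisker_right _ _ := Subsingleton.elim _ _
  map₂_associator _ _ _ := Subsingleton.elim _ _
  map₂_left_unitor _ := Subsingleton.elim _ _
  map₂_right_unitor _ := Subsingleton.elim _ _

open scoped Pseudofunctor.StrongTrans

/-- A family of morphisms that is natural up to isomorphism is a strong transformation. -/
def strongTrans {F G : Pseudofunctor B C} (app : ∀ X, F.obj X ⟶ G.obj X)
    (naturality : ∀ {X Y : B} (f : X ⟶ Y), Rel (F.map f ≫ app Y) (app X ≫ G.map f)) :
    F ⟶ G :=
  { app := app
    naturality := fun f => (naturality f).iso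
    naturality_naturality := fun _ => Subsingleton.elim _ _
    naturality_id := fun _ => Subsingleton.elim _ _
    naturality_comp := fun _ _ => Subsingleton.elim _ _ }

instance subsingleton_modification {F G : Pseudofunctor B C} (η θ : F ⟶ G) :
    Subsingleton (η ⟶ θ) :=
  ⟨fun _ _ => Pseudofunctor.StrongTrans.homCategory.ext fun _ => Subsingleton.elim _ _⟩

/-- A pointwise equivalence that is natural up to isomorphism is an equivalence of
pseudofunctors. -/
lemma nonempty_equivalence {F G : Pseudofunctor B C} (app : ∀ X, F.obj X ⟶ G.obj X)
    (inv : ∀ X, G.obj X ⟶ F.obj X) (app_inv : ∀ X, Rel (app X ≫ inv X) (𝟙 _))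
    (inv_app : ∀ X, Rel (inv X ≫ app X) (𝟙 _))
    (naturality : ∀ {X Y : B} (f : X ⟶ Y), Rel (F.map f ≫ app Y) (app X ≫ G.map f)) :
    Nonempty (Bicategory.Equivalence F G) := by
  -- Naturality of the pointwise inverse is automatic: conjugate the given square by `inv X` and
  -- `inv Y`, then cancel.
  have inv_naturality : ∀ {X Y : B} (f : X ⟶ Y),
      Rel (G.map f ≫ inv Y) (inv X ≫ F.map f) := fun {X Y} f => by
    have h₁ := Rel.comp_cancel (inv_app X) (𝟙 _) (G.map f ≫ inv Y)
    have h₂ := Rel.comp_cancel (app_inv Y) (inv X ≫ F.map f) (𝟙 _)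
    have h₃ := ((Rel.refl (inv X)).comp (naturality f)).comp (Rel.refl (inv Y))
    simp only [Category.assoc, Category.comp_id, Category.id_comp] at h₁ h₂ h₃
    exact h₁.symm.trans (h₃.symm.trans h₂)
  exact ⟨{
    hom := strongTrans app naturality
    inv := strongTrans inv inv_naturality
    unit := Pseudofunctor.StrongTrans.isoMk (fun X => (app_inv X).symm.iso)
      (fun _ => Subsingleton.elim _ _)
    counit := Pseudofunctor.StrongTrans.isoMk (fun X => (inv_app X).iso)
      (fun _ => Subsingleton.elim _ _)
    left_triangle := Iso.ext (Subsingleton.elim _ _) }⟩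

/-- A functor between locally ordered categories that is locally an equivalence of preorders and
surjective on objects up to equivalence is part of a biequivalence. -/
theorem biequivalent_of_functor (F : B ⥤ C)
    (map_le_map : ∀ {X Y : B} {f g : X ⟶ Y}, F.map f ≤ F.map g ↔ f ≤ g)
    (full : ∀ {X Y : B} (h : F.obj X ⟶ F.obj Y), ∃ f : X ⟶ Y, Rel (F.map f) h)
    (surj : ∀ Y : C, ∃ (X : B) (e : F.obj X ⟶ Y) (e' : Y ⟶ F.obj X),
      Rel (e ≫ e') (𝟙 _) ∧ Rel (e' ≫ e) (𝟙 _)) :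
    Biequivalent C B := by
  choose obj e e' he he' using surj
  choose lift lift_rel using @full
  have reflect : ∀ {X Y : B} {f g : X ⟶ Y}, Rel (F.map f) (F.map g) → Rel f g :=
    fun h => ⟨map_le_map.1 h.1, map_le_map.1 h.2⟩
  let F' : Pseudofunctor B C := pseudofunctor F.obj F.map map_le_map.2
    (fun X => .of_eq (F.map_id X)) (fun f g => .of_eq (F.map_comp f g))
  -- The inverse on morphisms conjugates by the chosen equivalences and then lifts along `F`. Its
  -- pseudofunctor laws are checked after applying `F`, which reflects `Rel`.
  let map {X Y : C} (h : X ⟶ Y) : obj X ⟶ obj Y := lift ((e X ≫ h) ≫ e' Y)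
  have map_rel {X Y : C} (h : X ⟶ Y) : Rel (F.map (map h)) ((e X ≫ h) ≫ e' Y) :=
    lift_rel _
  have map_naturality {X Y : C} (h : X ⟶ Y) : Rel (F.map (map h) ≫ e Y) (e X ≫ h) := by
    have h₁ := (map_rel h).comp (Rel.refl (e Y))
    have h₂ := Rel.comp_cancel (he' Y) (e X ≫ h) (𝟙 _)
    simp only [Category.comp_id] at h₂
    exact h₁.trans h₂
  let G' : Pseudofunctor C B := pseudofunctor obj map
    (fun {X Y f g} h => map_le_map.1 <| (map_rel f).1.trans <|
      (comp_mono (comp_mono le_rfl h) le_rfl).trans (map_rel g).2)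
    (fun X => reflect <| (map_rel _).trans <| by
      rw [Category.comp_id, F.map_id]; exact he X)
    (fun {X Y Z} f g => reflect <| by
      have h := Rel.comp_cancel (he' Y) (e X ≫ f) (g ≫ e' Z)
      rw [F.map_comp]
      refine ((map_rel (f ≫ g)).trans ?_).trans ((map_rel f).comp (map_rel g)).symm
      simp only [Category.assoc] at h ⊢
      exact h.symm)
  have lift_comp_lift {X Y Z : B} (h : F.obj X ⟶ F.obj Y) (k : F.obj Y ⟶ F.obj Z) :
      Rel (F.map (lift h ≫ lift k)) (h ≫ k) := by
    rw [F.map_comp]; exact (lift_rel h).comp (lift_rel k)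
  refine ⟨G', F', nonempty_equivalence (F := G'.comp F') (G := Pseudofunctor.id C) e e' he he'
    map_naturality, nonempty_equivalence (F := F'.comp G') (G := Pseudofunctor.id B)
      (fun X => lift (e (F.obj X))) (fun X => lift (e' (F.obj X)))
      (fun X => reflect ?_) (fun X => reflect ?_) (fun {X Y} f => reflect ?_)⟩
  · exact (lift_comp_lift _ _).trans ((he _).trans (.of_eq (F.map_id _).symm))
  · exact (lift_comp_lift _ _).trans ((he' _).trans (.of_eq (F.map_id _).symm))
  · refine (Rel.of_eq (F.map_comp _ _)).trans ?_
    refine Rel.trans ?_ (Rel.of_eq (F.map_comp _ _).symm)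
    exact (((Rel.refl _).comp (lift_rel _)).trans (map_naturality (F.map f))).trans
      ((lift_rel _).symm.comp (Rel.refl _))

end LocallyOrdered

/-! ### Principal elements of a module -/

variable {Q : Type u} [Quantaloid.{u} Q]

namespace QMod

variable (F : QMod Q)

lemma map_mono {X Y : Q} (f : X ⟶ Y) {y y' : F.obj Y} (h : y ≤ y') : F.map f y ≤ F.map f y' :=
  OrderHomClass.mono (F.map f) h

lemma iSup_map {X Y : Q} {ι : Sort*} (f : ι → (X ⟶ Y)) (y : F.obj Y) :
    F.map (⨆ i, f i) y = ⨆ i, F.map (f i) y := by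
  rw [iSup, F.sSup_map, ← Set.range_comp]; rfl

lemma map_le_map {X Y : Q} {f g : X ⟶ Y} (h : f ≤ g) (y : F.obj Y) : F.map f y ≤ F.map g y :=
  OrderHomClass.mono ((tau F y).app X) h

/-- The largest `f : X ⟶ A` with `F(f)(a) ≤ x`. -/
def hom {X A : Q} (a : F.obj A) (x : F.obj X) : X ⟶ A := sSup {f | F.map f a ≤ x}

variable {F}

lemma map_hom_le {X A : Q} (a : F.obj A) (x : F.obj X) : F.map (F.hom a x) a ≤ x := by
  rw [hom, F.sSup_map]
  refine sSup_le ?_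
  rintro _ ⟨f, hf, rfl⟩
  exact hf

lemma le_hom_iff {X A : Q} {a : F.obj A} {x : F.obj X} {f : X ⟶ A} :
    f ≤ F.hom a x ↔ F.map f a ≤ x :=
  ⟨fun h => (F.map_le_map h a).trans (map_hom_le a x), fun h => le_sSup h⟩

/-- This identifies the order underlying the enriched hom with the lattice order of `F(A)`, so that
the order on functors into `principal F` is the pointwise one. -/
lemma id_le_hom_iff {A : Q} {a b : F.obj A} : 𝟙 A ≤ F.hom a b ↔ a ≤ b := by
  rw [le_hom_iff, F.map_id]

lemma hom_comp_hom_le {X Y Z : Q} (a : F.obj Z) (b : F.obj Y) (x : F.obj X) :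
    F.hom b x ≫ F.hom a b ≤ F.hom a x := by
  rw [le_hom_iff, F.map_comp]
  exact (F.map_mono _ (map_hom_le a b)).trans (map_hom_le b x)

end QMod

namespace QModHom

variable {F G : QMod Q}

lemma mono (α : QModHom F G) {X : Q} {x y : F.obj X} (h : x ≤ y) : α.app X x ≤ α.app X y :=
  OrderHomClass.mono (α.app X) h

lemma hom_le_hom (α : QModHom F G) {X A : Q} (a : F.obj A) (x : F.obj X) :
    F.hom a x ≤ G.hom (α.app A a) (α.app X x) := by
  rw [QMod.le_hom_iff, ← α.naturality]
  exact α.mono (QMod.map_hom_le a x)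

end QModHom

namespace IsPrincipal

variable {F : QMod Q} {A : Q} {a : F.obj A}

lemma of_adjoint (ρ : QModHom F (representable A))
    (unit : ∀ (X : Q) (f : X ⟶ A), f ≤ ρ.app X (F.map f a))
    (counit : ∀ (X : Q) (x : F.obj X), F.map (ρ.app X x) a ≤ x) : IsPrincipal F a :=
  ⟨ρ, unit, counit⟩

/-- Right adjoints in ordered sets are unique, so the right adjoint of `τ_a` has to be `F.hom a -`,
which thereby inherits naturality and preservation of suprema. -/
lemma exists_adjoint (ha : IsPrincipal F a) :
    ∃ ρ : QModHom F (representable A), ∀ (X : Q) (x : F.obj X), ρ.app X x = F.hom a x := by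
  obtain ⟨ρ, unit, counit⟩ := ha
  refine ⟨ρ, fun X x => le_antisymm (QMod.le_hom_iff.2 (counit X x)) ?_⟩
  exact (unit X (F.hom a x)).trans (QModHom.mono ρ (QMod.map_hom_le a x))

lemma hom_map (ha : IsPrincipal F a) {X Y : Q} (f : X ⟶ Y) (y : F.obj Y) :
    F.hom a (F.map f y) = f ≫ F.hom a y := by
  obtain ⟨ρ, hρ⟩ := ha.exists_adjoint
  rw [← hρ, ← hρ]
  exact ρ.naturality f y

lemma hom_sSup (ha : IsPrincipal F a) {X : Q} (s : Set (F.obj X)) :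
    F.hom a (sSup s) = ⨆ x ∈ s, F.hom a x := by
  obtain ⟨ρ, hρ⟩ := ha.exists_adjoint
  simp only [← hρ]
  rw [map_sSup, sSup_image]
  rfl

lemma hom_iSup (ha : IsPrincipal F a) {X : Q} {ι : Sort*} (x : ι → F.obj X) :
    F.hom a (⨆ i, x i) = ⨆ i, F.hom a (x i) := by
  obtain ⟨ρ, hρ⟩ := ha.exists_adjoint
  simp only [← hρ]
  exact map_iSup (ρ.app X) x

/-- By Yoneda `τ_{α(a)} = α ∘ τ_a`, and left adjoints compose. -/
lemma map {G : QMod Q} (ha : IsPrincipal F a) {α : F ⟶ G} (hα : IsMap α) :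
    IsPrincipal G (QModHom.app α A a) := by
  have h : tau G (QModHom.app α A a) = tau F a ≫ α := by
    refine QModHom.ext (funext fun X => ?_)
    ext f
    exact (QModHom.naturality α f a).symm
  rw [IsPrincipal, h]
  exact IsMap.comp ha hα

end IsPrincipal

/-- The `Q`-category of principal elements of a module. -/
def principal (F : QMod Q) : QCat Q where
  Obj X := {a : F.obj X // IsPrincipal F a}
  hom a' a := F.hom a'.1 a.1
  hom_comp a'' a' a := QMod.hom_comp_hom_le a''.1 a'.1 a.1
  hom_id _ := QMod.id_le_hom_iff.2 le_rfl

/-- Principal generation in terms of elements, obtained by evaluating the defining equation at the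
identity. By Yoneda, the lifting `[τ_a, τ_x]` is the counterpart of the arrow `F.hom a x`. -/
lemma IsPrincipallyGenerated.le_iSup {F : QMod Q} (hF : IsPrincipallyGenerated F) {X : Q}
    (x : F.obj X) : x ≤ ⨆ (A : Q) (a : (principal F).Obj A), F.map (F.hom a.1 x) a.1 := by
  have h : x = (tau F x).app X (𝟙 X) := (F.map_id x).symm
  refine h.le.trans ?_
  rw [hF X x]
  refine iSup_le ?_
  rintro ⟨_, A, a, ha, rfl⟩
  refine le_iSup_of_le A (le_iSup_of_le ⟨a, ha⟩ ?_)
  change F.map ((lifting (tau F a) (tau F x)).app X (𝟙 X)) a ≤ _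
  refine F.map_le_map (QMod.le_hom_iff.2 ?_) a
  have h' := (le_lifting_iff (tau F a) (tau F x) _).1 le_rfl X (𝟙 X)
  exact h'.trans h.ge

lemma IsPrincipallyGenerated.of_le_iSup {F : QMod Q}
    (hF : ∀ (X : Q) (x : F.obj X),
      x ≤ ⨆ (A : Q) (a : (principal F).Obj A), F.map (F.hom a.1 x) a.1) :
    IsPrincipallyGenerated F := by
  intro X x
  refine le_antisymm ?_ (sSup_le ?_)
  · intro Y (f : Y ⟶ X)
    change F.map f x ≤ _
    refine (F.map_mono f (hF X x)).trans ?_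
    simp only [map_iSup]
    refine iSup_le fun A => iSup_le fun a => ?_
    -- Postcomposition with `F.hom a x` is a candidate in the supremum defining the lifting.
    have key : (tau (representable A) (F.hom a.1 x) : representable X ⟶ representable A) ≤
        lifting (tau F a.1) (tau F x) := by
      rw [le_lifting_iff]
      intro Z (g : Z ⟶ X)
      change F.map (g ≫ F.hom a.1 x) a.1 ≤ F.map g x
      rw [F.map_comp]
      exact F.map_mono g (QMod.map_hom_le a.1 x)
    rw [← F.map_comp]
    refine (F.map_le_map (key Y f) a.1).trans ?_
    exact _root_.le_iSup (fun α : {θ : QModHom (representable X) F | ∃ (A : Q) (a : F.obj A),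
        IsPrincipal F a ∧ θ = lifting (tau F a) (tau F x) ≫ tau F a} => α.1.app Y f)
      ⟨lifting (tau F a.1) (tau F x) ≫ tau F a.1, A, a.1, a.2, rfl⟩
  · rintro _ ⟨A, a, _, rfl⟩
    exact (le_lifting_iff _ _ _).1 le_rfl

/-- The module morphism `x ↦ ⋁ᵢ G([aᵢ, x])(bᵢ)` determined by a family of principal elements
`aᵢ` of `F` and a family of elements `bᵢ` of `G` of the same types. -/
def principalExtension {F G : QMod Q} {S : Q → Type u} (a : ∀ {A : Q}, S A → F.obj A)
    (b : ∀ {A : Q}, S A → G.obj A) (ha : ∀ {A : Q} (s : S A), IsPrincipal F (a s)) :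
    QModHom F G where
  app X :=
    { toFun := fun x => ⨆ (A : Q) (s : S A), G.map (F.hom (a s) x) (b s)
      map_sSup' := fun t => by
        -- Principality enters here: for a general element, `F.hom a -` need not commute with
        -- suprema or with the action.
        simp only [(ha _).hom_sSup, QMod.iSup_map, sSup_image]
        refine le_antisymm ?_ ?_
        · exact iSup_le fun A => iSup_le fun s => iSup₂_mono fun x _ =>
            le_iSup₂_of_le A s le_rfl
        · exact iSup₂_le fun x hx => iSup₂_mono fun A s => le_iSup₂_of_le x hx le_rfl }
  naturality f y := by
    change (⨆ (A : Q) (s : S A), G.map (F.hom (a s) (F.map f y)) (b s)) =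
      G.map f (⨆ (A : Q) (s : S A), G.map (F.hom (a s) y) (b s))
    simp only [(ha _).hom_map, map_iSup, G.map_comp]

section

variable {F G : QMod Q} {S : Q → Type u} {a : ∀ {A : Q}, S A → F.obj A}
  {b : ∀ {A : Q}, S A → G.obj A} {ha : ∀ {A : Q} (s : S A), IsPrincipal F (a s)}

lemma principalExtension_app_le {X : Q} {x : F.obj X} {y : G.obj X}
    (h : ∀ (A : Q) (s : S A), F.hom (a s) x ≤ G.hom (b s) y) :
    (principalExtension a b ha).app X x ≤ y :=
  iSup₂_le fun A s => QMod.le_hom_iff.1 (h A s)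

end

/-! ### The category of principal elements is Cauchy complete -/

/-- Given `Φ ⊣ Ψ`, the representing functor sends `a` to the colimit of principal elements weighted
by `Φ(-, a)`. The adjoint `Ψ` supplies a right adjoint to the `τ` of that colimit, making it
principal. -/
lemma isCauchyComplete_principal (F : QMod Q) : IsCauchyComplete (principal F) := by
  rintro A (Φ : Distributor A (principal F)) ⟨(Ψ : Distributor (principal F) A), unit, counit⟩
  have unit' : ∀ {X : Q} (a : A.Obj X),
      𝟙 X ≤ ⨆ (Y : Q) (b : (principal F).Obj Y), Φ.app b a ≫ Ψ.app a b :=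
    fun {X} a => (A.hom_id a).trans (unit X X a a)
  have counit' : ∀ {X Y Z : Q} (b : (principal F).Obj X) (a : A.Obj Y)
      (b' : (principal F).Obj Z), Ψ.app a b ≫ Φ.app b' a ≤ F.hom b'.1 b.1 :=
    fun {X Y Z} b a b' => (le_iSup₂_of_le (f := fun (Y : Q) (a : A.Obj Y) =>
      Ψ.app a b ≫ Φ.app b' a) Y a le_rfl).trans (counit X Z b' b)
  let H {X : Q} (a : A.Obj X) : F.obj X :=
    ⨆ (Y : Q) (b : (principal F).Obj Y), F.map (Φ.app b a) b.1
  have le_H {X Y : Q} (a : A.Obj X) (b : (principal F).Obj Y) : F.map (Φ.app b a) b.1 ≤ H a :=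
    le_iSup₂_of_le (f := fun (Y : Q) (b : (principal F).Obj Y) => F.map (Φ.app b a) b.1)
      Y b le_rfl
  have H_principal {X : Q} (a : A.Obj X) : IsPrincipal F (H a) := by
    refine .of_adjoint (principalExtension (G := representable X) (S := (principal F).Obj)
      (fun b => b.1) (fun b => Ψ.app a b) (fun b => b.2)) (fun Y f => ?_) (fun Y x => ?_)
    · have h := Quantaloid.comp_le_comp (le_refl f) (unit' a)
      simp only [Category.comp_id, Quantaloid.comp_iSup, ← Category.assoc] at h
      refine h.trans (iSup₂_mono fun Z b => Quantaloid.comp_le_comp ?_ le_rfl)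
      rw [QMod.le_hom_iff, F.map_comp]
      exact F.map_mono f (le_H a b)
    -- The counit of `Φ ⊣ Ψ` replaces `Φ(b', a) ∘ Ψ(a, b)` by `F.hom b' b`; evaluating first at `b'`
    -- and then at `b` gives something below `x`.
    · change F.map (⨆ (Z : Q) (b : (principal F).Obj Z), F.hom b.1 x ≫ Ψ.app a b) (H a) ≤ x
      rw [QMod.iSup_map]
      refine iSup_le fun Z => ?_
      rw [QMod.iSup_map]
      refine iSup_le fun b => ?_
      simp only [H, map_iSup, ← F.map_comp, Category.assoc]
      refine iSup₂_le fun W b' => ?_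
      rw [F.map_comp]
      exact (F.map_mono _ (QMod.le_hom_iff.1 (counit' b a b'))).trans (QMod.map_hom_le b.1 x)
  refine ⟨⟨fun a => ⟨H a, H_principal a⟩, fun a' a => QMod.le_hom_iff.2 ?_⟩, ?_⟩
  · simp only [H, map_iSup, ← F.map_comp]
    exact iSup₂_mono fun Y b => F.map_le_map (Φ.act_right b a' a) b.1
  · refine Distributor.ext ?_
    funext X Y b a
    change F.hom b.1 (H a) = Φ.app b a
    refine le_antisymm ?_ (QMod.le_hom_iff.2 (le_H a b))
    -- As `b` is principal, `F.hom b -` passes inside the colimit, where the left action of `Φ`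
    -- absorbs it.
    simp only [H, b.2.hom_iSup, b.2.hom_map]
    exact iSup₂_le fun Z b' => Φ.act_left b b' a

/-! ### Left adjoint module morphisms are functors between principal elements -/

/-- The functor between categories of principal elements induced by a left adjoint module
morphism. -/
def principalMap {F G : QMod Q} (α : F ⟶ G) (hα : IsMap α) :
    QFunctor (principal F) (principal G) where
  obj {X} a := ⟨QModHom.app α X a.1, a.2.map hα⟩
  hom_le a' a := QModHom.hom_le_hom α a'.1 a.1

variable (Q) in
/-- Taking principal elements, as a functor from principally generated modules and left adjoints
to Cauchy complete categories. -/
def principalFunctor : MapCat (ModPG Q) ⥤ CatCC Q where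
  obj F := ⟨principal F.obj.obj, isCauchyComplete_principal F.obj.obj⟩
  map α := principalMap (Q := Q) α.1 α.2
  map_id _ := rfl
  map_comp _ _ := rfl

lemma IsPrincipallyGenerated.le_of_le {F G : QMod Q} (hF : IsPrincipallyGenerated F)
    {α β : QModHom F G}
    (h : ∀ (A : Q) (a : (principal F).Obj A), α.app A a.1 ≤ β.app A a.1) : α ≤ β := by
  intro X x
  refine (α.mono (hF.le_iSup x)).trans ?_
  simp only [map_iSup, α.naturality]
  refine iSup₂_le fun A a => (G.map_mono _ (h A a)).trans ?_
  rw [← β.naturality]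
  exact β.mono (QMod.map_hom_le a.1 x)

lemma principalFunctor_map_le_map {F G : MapCat (ModPG Q)} {α β : F ⟶ G} :
    (principalFunctor Q).map α ≤ (principalFunctor Q).map β ↔ α ≤ β :=
  ⟨fun h => F.obj.property.le_of_le (α := α.1) (β := β.1)
      fun A a => QMod.id_le_hom_iff.1 (h A a),
    fun h A a => QMod.id_le_hom_iff.2 (h A a.1)⟩

/-- Here `α` is the left Kan extension of `H`, and the candidate right adjoint `β` is built in the
same way from the family `H a ↦ a`. Generation of `F` gives the unit; the counit follows from the
values of `α` on principal elements. -/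
lemma exists_isMap_extension {F G : QMod Q} (hF : IsPrincipallyGenerated F)
    (H : QFunctor (principal F) (principal G)) :
    ∃ α : F ⟶ G, IsMap α ∧
      ∀ (A : Q) (a : (principal F).Obj A), QModHom.app α A a.1 = (H.obj a).1 := by
  let α : QModHom F G := principalExtension (S := (principal F).Obj) (fun a => a.1)
    (fun a => (H.obj a).1) (fun a => a.2)
  let β : QModHom G F := principalExtension (S := (principal F).Obj) (fun a => (H.obj a).1)
    (fun a => a.1) (fun a => (H.obj a).2)
  have le_α {X A : Q} (x : F.obj X) (a : (principal F).Obj A) :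
      G.map (F.hom a.1 x) (H.obj a).1 ≤ α.app X x :=
    le_iSup₂_of_le (f := fun (A : Q) (a : (principal F).Obj A) =>
      G.map (F.hom a.1 x) (H.obj a).1) A a le_rfl
  have le_β {X A : Q} (y : G.obj X) (a : (principal F).Obj A) :
      F.map (G.hom (H.obj a).1 y) a.1 ≤ β.app X y :=
    le_iSup₂_of_le (f := fun (A : Q) (a : (principal F).Obj A) =>
      F.map (G.hom (H.obj a).1 y) a.1) A a le_rfl
  have α_principal (A : Q) (a : (principal F).Obj A) : α.app A a.1 = (H.obj a).1 := by
    -- One inequality is functoriality of `H`; the other takes the term of the join indexed by `a`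
    -- itself, where `𝟙 ≤ F.hom a a`.
    refine le_antisymm (principalExtension_app_le fun B b => H.hom_le b a) ?_
    exact QMod.id_le_hom_iff.1 ((QMod.id_le_hom_iff.2 le_rfl).trans
      (QMod.le_hom_iff.2 (le_α a.1 a)))
  refine ⟨α, ⟨β, fun X x => ?_, fun X y => ?_⟩, α_principal⟩
  · change x ≤ β.app X (α.app X x)
    refine (hF.le_iSup x).trans (iSup₂_le fun A a => ?_)
    exact (F.map_le_map (QMod.le_hom_iff.2 (le_α x a)) a.1).trans (le_β _ a)
  · change α.app X (⨆ (A : Q) (a : (principal F).Obj A), F.map (G.hom (H.obj a).1 y) a.1) ≤ y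
    simp only [map_iSup, α.naturality, α_principal]
    exact iSup₂_le fun A a => QMod.map_hom_le _ y

lemma principalFunctor_full {F G : MapCat (ModPG Q)}
    (H : (principalFunctor Q).obj F ⟶ (principalFunctor Q).obj G) :
    ∃ α : F ⟶ G, (principalFunctor Q).map α = H := by
  obtain ⟨α, hα, h⟩ := exists_isMap_extension F.obj.property H
  refine ⟨⟨α, hα⟩, QFunctor.ext ?_⟩
  funext X a
  exact Subtype.ext (h X a)

/-! ### Presheaves on an enriched category -/

/-- A presheaf of type `X` on `C`, i.e. a distributor into `C` from the one-object category on
`X`. -/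
@[ext]
structure Presheaf (C : QCat Q) (X : Q) where
  app : ∀ {Y : Q}, C.Obj Y → (X ⟶ Y)
  act : ∀ {Y Z : Q} (c' : C.Obj Z) (c : C.Obj Y), app c ≫ C.hom c' c ≤ app c'

namespace Presheaf

variable {C : QCat Q}

instance (X : Q) : PartialOrder (Presheaf C X) where
  le φ ψ := ∀ (Y : Q) (c : C.Obj Y), φ.app c ≤ ψ.app c
  le_refl _ _ _ := le_rfl
  le_trans _ _ _ h h' Y c := (h Y c).trans (h' Y c)
  le_antisymm φ ψ h h' := by
    ext Y c
    exact le_antisymm (h Y c) (h' Y c)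

instance (X : Q) : SupSet (Presheaf C X) where
  sSup S :=
    { app := fun c => ⨆ φ : S, φ.1.app c
      act := fun c' c => by
        rw [Quantaloid.iSup_comp]
        exact iSup_mono fun φ => φ.1.act c' c }

instance (X : Q) : CompleteLattice (Presheaf C X) :=
  completeLatticeOfSup _ fun S =>
    ⟨fun φ hφ _ c => le_iSup (fun φ : S => φ.1.app c) ⟨φ, hφ⟩,
      fun _ hψ Y c => iSup_le fun φ => hψ φ.2 Y c⟩

lemma sSup_app {X Y : Q} (S : Set (Presheaf C X)) (c : C.Obj Y) :
    (sSup S).app c = ⨆ φ : S, φ.1.app c := rfl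

/-- The presheaf `C(-, c)`. -/
def yoneda {X : Q} (c : C.Obj X) : Presheaf C X where
  app c' := C.hom c' c
  act c'' c' := C.hom_comp c'' c' c

end Presheaf

/-- The module of presheaves on an enriched category. -/
def presheafModule (C : QCat Q) : QMod Q where
  obj := Presheaf C
  lattice _ := inferInstance
  map f :=
    { toFun := fun φ =>
        { app := fun c => f ≫ φ.app c
          act := fun c' c => by
            rw [Category.assoc]
            exact Quantaloid.comp_le_comp le_rfl (φ.act c' c) }
      map_sSup' := fun S => by
        ext Y c
        simp only [Presheaf.sSup_app, Quantaloid.comp_iSup]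
        refine le_antisymm (iSup_le fun φ => le_iSup_of_le ⟨_, φ.1, φ.2, rfl⟩ le_rfl)
          (iSup_le ?_)
        rintro ⟨_, φ, hφ, rfl⟩
        exact le_iSup_of_le ⟨φ, hφ⟩ le_rfl }
  map_id φ := Presheaf.ext (by funext Y c; exact Category.id_comp _)
  map_comp f g φ := Presheaf.ext (by funext Y c; exact Category.assoc _ _ _)
  sSup_map S φ := by
    refine Presheaf.ext ?_
    funext Y c
    change sSup S ≫ φ.app c = _
    rw [sSup_eq_iSup', Quantaloid.iSup_comp, Presheaf.sSup_app]
    refine le_antisymm (iSup_le fun f => le_iSup_of_le ⟨_, f.1, f.2, rfl⟩ le_rfl) (iSup_le ?_)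
    rintro ⟨_, f, hf, rfl⟩
    exact le_iSup_of_le (f := fun f : S => f.1 ≫ φ.app c) ⟨f, hf⟩ le_rfl

section

variable {C : QCat Q}

/-- Evaluation of presheaves at an object. -/
def presheafEval {A : Q} (c : C.Obj A) : QModHom (presheafModule C) (representable A) where
  app X :=
    { toFun := fun φ : Presheaf C X => φ.app c
      map_sSup' := fun _ =>
        (sSup_image' (f := fun φ : Presheaf C X => φ.app c)).symm }
  naturality _ _ := rfl

lemma map_yoneda_le_iff {X A : Q} (c : C.Obj A) (φ : (presheafModule C).obj X) (f : X ⟶ A) :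
    (presheafModule C).map f (Presheaf.yoneda c) ≤ φ ↔ f ≤ Presheaf.app φ c := by
  constructor
  · intro h
    refine le_trans ?_ (h A c)
    have h' := Quantaloid.comp_le_comp (le_refl f) (C.hom_id c)
    rwa [Category.comp_id] at h'
  · exact fun h Y c' => (Quantaloid.comp_le_comp h le_rfl).trans (Presheaf.act φ c' c)

/-- The enriched Yoneda lemma. -/
lemma hom_yoneda {X A : Q} (c : C.Obj A) (φ : (presheafModule C).obj X) :
    (presheafModule C).hom (Presheaf.yoneda c : Presheaf C A) φ = Presheaf.app φ c :=
  eq_of_forall_le_iff fun _ => QMod.le_hom_iff.trans (map_yoneda_le_iff c φ _)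

lemma isPrincipal_yoneda {A : Q} (c : C.Obj A) :
    IsPrincipal (presheafModule C) (Presheaf.yoneda c : Presheaf C A) :=
  .of_adjoint (presheafEval c) (fun _ _ => (map_yoneda_le_iff c _ _).1 le_rfl)
    (fun _ φ => (map_yoneda_le_iff c φ _).2 le_rfl)

/-- Every representable presheaf is a principal element of the module of presheaves. -/
def principalYoneda (C : QCat Q) : QFunctor C (principal (presheafModule C)) where
  obj c := ⟨Presheaf.yoneda c, isPrincipal_yoneda c⟩
  hom_le c' c := (hom_yoneda c' (Presheaf.yoneda c)).ge

/-- Density: a presheaf is generated by representables, weighted by its own values. -/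
lemma presheaf_le_iSup {X : Q} (φ : (presheafModule C).obj X) :
    φ ≤ ⨆ (A : Q) (c : C.Obj A),
      (presheafModule C).map (Presheaf.app φ c) (Presheaf.yoneda c) := by
  intro Y c
  exact (map_yoneda_le_iff c _ _).1 (le_iSup₂_of_le (f := fun (A : Q) (c : C.Obj A) =>
    (presheafModule C).map (Presheaf.app φ c) (Presheaf.yoneda c)) Y c le_rfl)

lemma isPrincipallyGenerated_presheafModule (C : QCat Q) :
    IsPrincipallyGenerated (presheafModule C) :=
  .of_le_iSup fun _ φ => (presheaf_le_iSup φ).trans <| iSup₂_le fun A c =>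
    le_iSup₂_of_le (f := fun (A : Q) (a : (principal (presheafModule C)).Obj A) =>
      (presheafModule C).map ((presheafModule C).hom a.1 φ) a.1) A ((principalYoneda C).obj c)
      ((presheafModule C).map_le_map (hom_yoneda c φ).ge _)

/-- The distributor from the principal presheaves on `C` to `C` given by evaluation. -/
def evalDistributor (C : QCat Q) : Distributor (principal (presheafModule C)) C where
  app c φ := Presheaf.app φ.1 c
  act_left c c' φ := Presheaf.act φ.1 c c'
  act_right c φ' φ := QMod.map_hom_le (F := presheafModule C) φ'.1 φ.1 _ c

/-- Expand `φ` by density; principality of `ψ` moves its hom inside the join. This is the unit of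
the adjunction in `isMap_evalDistributor`. -/
lemma hom_le_iSup_comp_hom_yoneda {X Y : Q} {ψ : (presheafModule C).obj Y}
    (hψ : IsPrincipal (presheafModule C) ψ) (φ : (presheafModule C).obj X) :
    (presheafModule C).hom ψ φ ≤ ⨆ (A : Q) (c : C.Obj A),
      Presheaf.app φ c ≫ (presheafModule C).hom ψ (Presheaf.yoneda c) := by
  refine (QMod.le_hom_iff.2 ((QMod.map_hom_le ψ φ).trans (presheaf_le_iSup φ))).trans
    (le_of_eq ?_)
  exact (hψ.hom_iSup _).trans <| iSup_congr fun A => (hψ.hom_iSup _).trans <|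
    iSup_congr fun c => hψ.hom_map _ _

/-- The right adjoint is represented by the Yoneda embedding, so with the unit above and evaluation
as counit, `C` and its principal presheaves are linked by a left adjoint to which Cauchy
completeness applies. -/
lemma isMap_evalDistributor (C : QCat Q) :
    IsMap (X := DistCat.mk (principal (presheafModule C))) (Y := DistCat.mk C)
      (evalDistributor C) := by
  refine ⟨(principalYoneda C).represented, fun X Y φ' φ => ?_, fun X Y c' c => ?_⟩
  · exact hom_le_iSup_comp_hom_yoneda φ'.2 φ.1
  · exact iSup₂_le fun Z φ => QMod.map_hom_le (F := presheafModule C) φ.1 _ _ c'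

/-- A Cauchy complete category is equivalent to the category of principal presheaves on it. -/
lemma exists_inverse_principalYoneda (hC : IsCauchyComplete C) :
    ∃ S : QFunctor (principal (presheafModule C)) C,
      (∀ (X : Q) (φ : (principal (presheafModule C)).Obj X),
        (principalYoneda C).obj (S.obj φ) = φ) ∧
      ∀ (X : Q) (c : C.Obj X), 𝟙 X ≤ C.hom c (S.obj ((principalYoneda C).obj c)) ∧
        𝟙 X ≤ C.hom (S.obj ((principalYoneda C).obj c)) c := by
  obtain ⟨S, hS⟩ := hC _ _ (isMap_evalDistributor C)
  have app {X Y : Q} (c : C.Obj Y) (φ : (principal (presheafModule C)).Obj X) :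
      C.hom c (S.obj φ) = Presheaf.app φ.1 c :=
    congrArg (fun Φ : Distributor (principal (presheafModule C)) C => Φ.app c φ) hS
  -- `C(-, S φ) = φ` holds on the nose, whereas `S` of the presheaf represented by `c` is only
  -- isomorphic to `c`, since distinct objects of `C` may be isomorphic.
  refine ⟨S, fun X φ => Subtype.ext (Presheaf.ext ?_), fun X c => ⟨?_, ?_⟩⟩
  · funext Y c
    exact app c φ
  · exact (C.hom_id c).trans (app c ((principalYoneda C).obj c)).ge
  · exact (C.hom_id _).trans (app _ ((principalYoneda C).obj c)).le

end

lemma principalFunctor_surjective (C : CatCC Q) :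
    ∃ (F : MapCat (ModPG Q)) (e : (principalFunctor Q).obj F ⟶ C)
      (e' : C ⟶ (principalFunctor Q).obj F),
      LocallyOrdered.Rel (e ≫ e') (𝟙 _) ∧ LocallyOrdered.Rel (e' ≫ e) (𝟙 _) := by
  obtain ⟨S, h, h'⟩ := exists_inverse_principalYoneda C.property
  refine ⟨⟨⟨presheafModule C.obj, isPrincipallyGenerated_presheafModule C.obj⟩⟩, S,
    principalYoneda C.obj, .of_eq (QFunctor.ext ?_),
    fun X c => (h' X c).2, fun X c => (h' X c).1⟩
  funext X φ
  exact h X φ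

end Qtld

theorem corollary13p1 (Q : Type u) [Qtld.Quantaloid.{u, u} Q] :
    Qtld.Biequivalent (Qtld.CatCC Q) (Qtld.MapCat (Qtld.ModPG Q)) := by
  refine Qtld.LocallyOrdered.biequivalent_of_functor (Qtld.principalFunctor Q)
    Qtld.principalFunctor_map_le_map (fun H => ?_) Qtld.principalFunctor_surjective
  obtain ⟨α, hα⟩ := Qtld.principalFunctor_full H
  exact ⟨α, .of_eq hα⟩
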